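/- **Almost complete broadcasting in hypercubes.** Let $0<\alpha<1$ be a constant and $X:=\frac1{\alpha(1-\alpha)}$. Consider the $d$-dimensional hypercube $Q_d$ as a synchronous message-passing network. All vertices run the same deterministic protocol; a vertex knows only whether it is the initiator, and distinguishes its $d$ incident links by arbitrary local port numbers. In each time step every vertex may send one message along each of its outgoing arcs, depending on its state; if $m$ messages are sent in the step, an adversary may destroy up to $\max\{c(Q_d)-1,\lfloor\alpha m\rfloor\}$ of them, where $c$ denotes edge connectivity. The other messages are delivered, and then the vertices update their states; a sender is not told whether its message was delivered. At the beginning only the initiator is *informed*; a vertex becomes informed when a message from an informed vertex is delivered to it. An arc that leads from an informed vertex is *passive* if some message has been delivered via the opposite arc; it is *hyperactive* if it leads to an informed vertex and is not passive. **Theorem.** Let $\varepsilon\in(0,1)$. There are constants $C$ and $d_0$, depending only on $\alpha$ and $\varepsilon$, such that for every $d\ge d_0$ there is a protocol for $Q_d$ with the following property. For every port numbering, every initiator and every behaviour of the adversary, only informed vertices ever send messages, and within at most $C d^2$ time steps a moment $t$ (which may depend on the adversary's behaviour) is reached such that * at time $t$, and at all later times, at most $X/(1-\varepsilon)$ vertices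 are uninformed, and * at time $t$ at most $X(d-1)$ arcs are hyperactive. -/

import Mathlib

/-- The edge connectivity `c(G)`: the largest `k` such that `G` stays connected after the removal of
any fewer than `k` edges (for a graph with at least two vertices). -/
noncomputable def edgeConnectivity {V : Type*} (G : SimpleGraph V) : ℕ :=
  sSup {k : ℕ | G.IsEdgeConnected k}

/-- Fractional dynamic faults with threshold: if `m` messages are sent in a step, up to
`max {c(G) - 1, ⌊α m⌋}` of them may be lost. -/
noncomputable def faultBound {V : Type*} (G : SimpleGraph V) (α : ℝ) (m : ℕ) : ℕ :=
  max (edgeConnectivity G - 1) ⌊α * (m : ℝ)⌋₊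

namespace Hypercube

/-- The vertices of `Q_d` are the binary words of length `d`. -/
abbrev Vertex (d : ℕ) : Type := Fin d → Bool

/-- The neighbour of `v` in direction `i`. -/
def flip {d : ℕ} (v : Vertex d) (i : Fin d) : Vertex d := Function.update v i (!(v i))

theorem flip_ne {d : ℕ} (v : Vertex d) (i : Fin d) : flip v i ≠ v := by
  intro h
  have := congrFun h i
  simp [flip] at this

theorem flip_flip {d : ℕ} (v : Vertex d) (i : Fin d) : flip (flip v i) i = v := by
  simp [flip]

/-- The `d`-dimensional hypercube `Q_d`. -/
def graph (d : ℕ) : SimpleGraph (Vertex d) where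
  Adj u v := ∃ i, v = flip u i
  symm := ⟨by
    rintro u v ⟨i, rfl⟩
    exact ⟨i, (flip_flip u i).symm⟩⟩
  loopless := ⟨fun u h => by
    obtain ⟨i, hi⟩ := h
    exact flip_ne u i hi.symm⟩

/-- An arc (directed edge) of `Q_d`: the pair `(v, i)` is the arc from `v` to `flip v i`. -/
abbrev Arc (d : ℕ) : Type := Vertex d × Fin d

/-- The vertex to which an arc leads. -/
def Arc.head {d : ℕ} (e : Arc d) : Vertex d := flip e.1 e.2

/-- The opposite arc. -/
def Arc.opposite {d : ℕ} (e : Arc d) : Arc d := (flip e.1 e.2, e.2)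

/-- A deterministic synchronous message-passing protocol for the vertices of a `d`-regular network.
Every vertex runs the same program. It knows whether it is the initiator, and it can tell its `d`
incident links apart by local port numbers, but it is given neither its own name nor the
directions of its links. -/
structure Protocol (d : ℕ) where
  /-- local states -/
  State : Type
  /-- messages -/
  Msg : Type
  /-- the initial state; the argument says whether the vertex is the initiator -/
  init : Bool → State
  /-- the message, if any, that a vertex in the given state sends through the given port -/
  send : State → Fin d → Option Msg
  /-- the next state, from the present one and the messages, if any, delivered through the ports -/
  next : State → (Fin d → Option Msg) → State

/-- What the environment of a protocol chooses: how the links are numbered at every vertex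
(port `p` of `v` is the link in direction `port v p`), the initiator, and the adversary's moves:
the set of arcs whose messages are lost, for every time step. -/
structure Run {d : ℕ} (P : Protocol d) where
  port : Vertex d → Equiv.Perm (Fin d)
  initiator : Vertex d
  lost : ℕ → Finset (Arc d)

namespace Run

variable {d : ℕ} {P : Protocol d} (R : Run P)

/-- The message that is sent along an arc when the vertices are in the states `σ`. -/
def message (σ : Vertex d → P.State) (e : Arc d) : Option P.Msg :=
  P.send (σ e.1) ((R.port e.1).symm e.2)

open Classical in
/-- The states of all vertices after `t` time steps. In each step every vertex sends messages
according to its state, and then updates its state by the messages that reach it. -/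
noncomputable def state : ℕ → Vertex d → P.State
  | 0 => fun v => P.init (decide (v = R.initiator))
  | t + 1 => fun v => P.next (state t v) fun p =>
      let e : Arc d := Arc.opposite (v, R.port v p)
      if e ∈ R.lost t then none else R.message (state t) e

open Classical in
/-- The arcs along which a message is sent in time step `t` (steps are numbered from `0`). -/
noncomputable def sent (t : ℕ) : Finset (Arc d) :=
  Finset.univ.filter fun e => (R.message (R.state t) e).isSome

open Classical in
/-- The arcs along which a message sent in time step `t` is delivered. -/
noncomputable def delivered (t : ℕ) : Finset (Arc d) := R.sent t \ R.lost t

/-- The adversary respects the fault bound in every time step. -/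
def Admissible (α : ℝ) : Prop :=
  ∀ t, R.lost t ⊆ R.sent t ∧ (R.lost t).card ≤ faultBound (graph d) α (R.sent t).card

open Classical in
/-- The vertices that are informed after `t` time steps: initially the initiator only; a vertex
becomes informed when a message from an informed vertex is delivered to it. -/
noncomputable def informed : ℕ → Finset (Vertex d)
  | 0 => {R.initiator}
  | t + 1 => informed t ∪
      Finset.univ.filter fun v => ∃ e ∈ R.delivered t, e.1 ∈ informed t ∧ e.head = v

open Classical in
/-- The vertices that are not informed after `t` time steps. -/
noncomputable def uninformed (t : ℕ) : Finset (Vertex d) := Finset.univ \ R.informed t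

/-- After `t` time steps the arc `e` is passive: it leads from an informed vertex, and some message
has been delivered via the opposite arc. -/
def IsPassive (t : ℕ) (e : Arc d) : Prop :=
  e.1 ∈ R.informed t ∧ ∃ s < t, e.opposite ∈ R.delivered s

open Classical in
/-- The arcs that are hyperactive after `t` time steps: those that lead from an informed vertex to
an informed vertex and are not passive. -/
noncomputable def hyperactive (t : ℕ) : Finset (Arc d) :=
  Finset.univ.filter fun e =>
    e.1 ∈ R.informed t ∧ e.head ∈ R.informed t ∧ ¬ R.IsPassive t e

/-- Only informed vertices send messages. -/
def OnlyInformedSend : Prop := ∀ t, ∀ e ∈ R.sent t, e.1 ∈ R.informed t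

end Run

end Hypercube

/-!
Call an arc *active* if it leads from an informed vertex and is not passive; the active arcs are the
hyperactive ones and the boundary arcs of the set of informed vertices. The network is synchronous,
so all vertices know the parity of the time, and a round of the protocol consists of two steps: in
the first, messages are sent along all active arcs; in the second, every message received in the
first is acknowledged along the opposite arc. An acknowledgement that is delivered turns an active
arc into a passive one. Put `X = 1 / (α (1 - α))`. If `m ≥ X (d - 1)` arcs are active, then at least
`(1 - α) m` messages are delivered, and since this is still at least `(d - 1) / α`, at least
`(1 - α) ^ 2 m` acknowledgements are delivered as well (`Run.card_passive_add_le`).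

As the boundary of the informed set is active, edge isoperimetry shows that the passive arcs are at
most `d m` in number if at most half of the vertices are informed, and that the other arcs are at
most `(d + 1) m` in number otherwise (`Run.passive_le_or_nonpassive_le`). In both cases a round
multiplies the ratio of the numbers of passive and other arcs by `1 + (1 - α) ^ 2 / (d + 1)` or more
(`ratio_growth`). This ratio lies between `1 / (d 2 ^ d)` and `d 2 ^ d`, so after `O(d ^ 2)` rounds
there are at most `X (d - 1)` active arcs (`Run.exists_card_active_le`).

At such a moment at most `X (d - 1)` arcs are hyperactive, and the boundary of the informed set is
as small. By the isoperimetric inequality `mul_sub_logb_le_card_boundary`, a set of at most half of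
the vertices with so small a boundary has at most `X / (1 - ε)` elements
(`exists_forall_card_le_of_card_boundary_le`). The informed set is not of this kind, because the
first two rounds already inform more than any given constant number of vertices
(`Run.le_card_informed_four`); so its complement is.
-/

namespace Hypercube

/-! ### Edge isoperimetry in the hypercube -/

/-- The induction step of the edge-isoperimetric inequality: slices of sizes `a ≤ b` are joined by
at most `a` edges. -/
theorem mul_logb_add_mul_logb_le {a b : ℝ} (ha : 0 ≤ a) (hab : a ≤ b) :
    a * Real.logb 2 a + b * Real.logb 2 b + 2 * a ≤ (a + b) * Real.logb 2 (a + b) := by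
  rcases ha.eq_or_lt with rfl | ha
  · simp
  have hb : 0 < b := ha.trans_le hab
  have h1 : 1 + Real.logb 2 a ≤ Real.logb 2 (a + b) := by
    rw [← Real.logb_self_eq_one (b := 2) one_lt_two, ← Real.logb_mul two_ne_zero ha.ne']
    exact Real.logb_le_logb_of_le one_lt_two (by positivity) (by linarith)
  -- Bernoulli's inequality `2 ^ y ≤ 1 + y` on `[0, 1]`, at `y = a / b`
  have h2 : a / b + Real.logb 2 b ≤ Real.logb 2 (a + b) := by
    have hB := rpow_one_add_le_one_add_mul_self (s := 1) (by norm_num)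
      (div_nonneg ha.le hb.le) ((div_le_one hb).2 hab)
    have h3 : a / b ≤ Real.logb 2 (1 + a / b) := by
      rw [Real.le_logb_iff_rpow_le one_lt_two (by positivity)]
      norm_num at hB ⊢
      exact hB
    have h4 : a + b = (1 + a / b) * b := by field_simp; ring
    rw [h4, Real.logb_mul (by positivity) hb.ne']
    linarith
  have h3 : b * (a / b + Real.logb 2 b) ≤ b * Real.logb 2 (a + b) :=
    mul_le_mul_of_nonneg_left h2 hb.le
  have h4 : b * (a / b) = a := by field_simp
  nlinarith [mul_le_mul_of_nonneg_left h1 ha.le]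

theorem flip_cons_zero {d : ℕ} (b : Bool) (w : Vertex d) :
    flip (Fin.cons b w : Vertex (d + 1)) 0 = Fin.cons (!b) w := by
  simp [flip, Fin.update_cons_zero]

theorem flip_cons_succ {d : ℕ} (b : Bool) (w : Vertex d) (i : Fin d) :
    flip (Fin.cons b w : Vertex (d + 1)) i.succ = Fin.cons b (flip w i) := by
  simp [flip, Fin.cons_update]

/-- The number of arcs with both ends in `S`, that is, twice the number of edges inside `S`. -/
def innerCard {d : ℕ} (S : Finset (Vertex d)) : ℕ :=
  ∑ v : Vertex d, ∑ i : Fin d, if v ∈ S ∧ flip v i ∈ S then 1 else 0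

/-- The slice of `S` on which the first coordinate is `b`. -/
def slice {d : ℕ} (S : Finset (Vertex (d + 1))) (b : Bool) : Finset (Vertex d) :=
  Finset.univ.filter fun w => (Fin.cons b w : Vertex (d + 1)) ∈ S

theorem sum_vertex_succ {d : ℕ} (f : Vertex (d + 1) → ℕ) :
    ∑ v, f v = ∑ w : Vertex d, f (Fin.cons false w) + ∑ w : Vertex d, f (Fin.cons true w) := by
  rw [← (Fin.consEquiv fun _ : Fin (d + 1) => Bool).sum_comp f, Fintype.sum_prod_type]
  simp [Fin.consEquiv, add_comm]

theorem card_slice_add {d : ℕ} (S : Finset (Vertex (d + 1))) :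
    (slice S false).card + (slice S true).card = S.card := by
  have h : S.card = ∑ v : Vertex (d + 1), if v ∈ S then 1 else 0 := by simp
  rw [h, sum_vertex_succ]
  simp only [slice, Finset.card_filter]

theorem innerCard_succ {d : ℕ} (S : Finset (Vertex (d + 1))) :
    innerCard S = innerCard (slice S false) + innerCard (slice S true)
      + 2 * (slice S false ∩ slice S true).card := by
  have h : (slice S false ∩ slice S true).card =
      ∑ w : Vertex d, if (Fin.cons false w : Vertex (d + 1)) ∈ S ∧
        (Fin.cons true w : Vertex (d + 1)) ∈ S then 1 else 0 := by
    rw [← Finset.card_filter]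
    congr 1
    ext w
    simp [slice]
  rw [h, innerCard, sum_vertex_succ]
  simp only [Fin.sum_univ_succ, flip_cons_zero, flip_cons_succ, Finset.sum_add_distrib,
    Bool.not_false, Bool.not_true, innerCard, slice, Finset.mem_filter, Finset.mem_univ, true_and]
  simp only [and_comm (a := (Fin.cons true _ : Vertex (d + 1)) ∈ S)
    (b := (Fin.cons false _ : Vertex (d + 1)) ∈ S)]
  ring

/-- A set of `k` vertices of the hypercube spans at most `(k log₂ k) / 2` edges. -/
theorem innerCard_le {d : ℕ} (S : Finset (Vertex d)) :
    (innerCard S : ℝ) ≤ S.card * Real.logb 2 S.card := by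
  induction d with
  | zero =>
    have : innerCard S = 0 := by simp [innerCard]
    rw [this]
    rcases S.card.eq_zero_or_pos with h | h
    · simp [h]
    · have : (1 : ℝ) ≤ S.card := by exact_mod_cast h
      have := Real.logb_nonneg one_lt_two this
      simp only [Nat.cast_zero]
      positivity
  | succ d ih =>
    have h0 := ih (slice S false)
    have h1 := ih (slice S true)
    have hc : ((slice S false).card : ℝ) + (slice S true).card = S.card := by
      exact_mod_cast card_slice_add S
    have hi : (innerCard S : ℝ) = innerCard (slice S false) + innerCard (slice S true)
      + 2 * (slice S false ∩ slice S true).card := by exact_mod_cast innerCard_succ S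
    have hl : ((slice S false ∩ slice S true).card : ℝ) ≤ (slice S false).card := by
      exact_mod_cast Finset.card_le_card Finset.inter_subset_left
    have hr : ((slice S false ∩ slice S true).card : ℝ) ≤ (slice S true).card := by
      exact_mod_cast Finset.card_le_card Finset.inter_subset_right
    rw [hi, ← hc]
    rcases le_total ((slice S false).card : ℝ) (slice S true).card with h | h
    · have := mul_logb_add_mul_logb_le (Nat.cast_nonneg _) h
      linarith
    · have := mul_logb_add_mul_logb_le (Nat.cast_nonneg _) h
      rw [add_comm ((slice S false).card : ℝ)]
      linarith

/-- The arcs that leave `S`. -/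
def boundary {d : ℕ} (S : Finset (Vertex d)) : Finset (Arc d) :=
  Finset.univ.filter fun e => e.1 ∈ S ∧ e.head ∉ S

theorem card_arcs_within {d : ℕ} (S : Finset (Vertex d)) :
    (Finset.univ.filter fun e : Arc d => e.1 ∈ S ∧ e.head ∈ S).card = innerCard S := by
  rw [Finset.card_filter, Fintype.sum_prod_type]
  rfl

theorem card_arcs_from {d : ℕ} (S : Finset (Vertex d)) :
    (Finset.univ.filter fun e : Arc d => e.1 ∈ S).card = S.card * d := by
  have : (Finset.univ.filter fun e : Arc d => e.1 ∈ S) = S ×ˢ Finset.univ := by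
    ext e; simp
  rw [this, Finset.card_product, Finset.card_univ, Fintype.card_fin]

theorem card_boundary_add_innerCard {d : ℕ} (S : Finset (Vertex d)) :
    (boundary S).card + innerCard S = S.card * d := by
  rw [← card_arcs_within, ← card_arcs_from S,
    ← Finset.card_filter_add_card_filter_not (s := Finset.univ.filter fun e : Arc d => e.1 ∈ S)
      (fun e => e.head ∈ S), Finset.filter_filter, Finset.filter_filter, add_comm,
    boundary]

/-- The edge-isoperimetric inequality of the hypercube. -/
theorem mul_sub_logb_le_card_boundary {d : ℕ} (S : Finset (Vertex d)) :
    (S.card : ℝ) * (d - Real.logb 2 S.card) ≤ (boundary S).card := by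
  have h : ((boundary S).card : ℝ) + innerCard S = S.card * d := by
    exact_mod_cast card_boundary_add_innerCard S
  linarith [innerCard_le S]

theorem Arc.opposite_opposite {d : ℕ} (e : Arc d) : e.opposite.opposite = e := by
  exact Prod.ext (flip_flip e.1 e.2) rfl

theorem Arc.opposite_injective {d : ℕ} : Function.Injective (Arc.opposite (d := d)) :=
  Function.LeftInverse.injective Arc.opposite_opposite

theorem Arc.head_opposite {d : ℕ} (e : Arc d) : e.opposite.head = e.1 := by
  exact flip_flip e.1 e.2

theorem card_boundary_compl {d : ℕ} (S : Finset (Vertex d)) :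
    (boundary Sᶜ).card = (boundary S).card := by
  refine Finset.card_bij' (fun e _ => e.opposite) (fun e _ => e.opposite) ?_ ?_ ?_ ?_
  · intro e he
    simp only [boundary, Finset.mem_filter, Finset.mem_univ, true_and, Finset.mem_compl,
      not_not, Arc.head_opposite] at he ⊢
    exact ⟨he.2, he.1⟩
  · intro e he
    simp only [boundary, Finset.mem_filter, Finset.mem_univ, true_and, Finset.mem_compl,
      not_not, Arc.head_opposite] at he ⊢
    exact ⟨he.2, he.1⟩
  · intro e _
    exact e.opposite_opposite
  · intro e _
    exact e.opposite_opposite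

theorem Arc.eq_of_tail_head {d : ℕ} {e f : Arc d} (h1 : e.1 = f.1) (h2 : e.head = f.head) :
    e = f := by
  obtain ⟨v, i⟩ := e
  obtain ⟨w, j⟩ := f
  obtain rfl : v = w := h1
  by_contra hne
  have hij : i ≠ j := fun h => hne (by rw [h])
  have h3 : flip v i i = flip v j i := congrFun h2 i
  rw [flip, flip, Function.update_self, Function.update_of_ne hij] at h3
  exact Bool.not_ne_self _ h3

/-- A set of at most half of the vertices has at least as many outgoing arcs as elements. -/
theorem card_le_card_boundary {d : ℕ} (S : Finset (Vertex d)) (h : 2 * S.card ≤ 2 ^ d) :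
    (S.card : ℝ) ≤ (boundary S).card := by
  rcases S.card.eq_zero_or_pos with h0 | h0
  · simp [h0]
  refine le_trans ?_ (mul_sub_logb_le_card_boundary S)
  have hpos : (0 : ℝ) < S.card := by exact_mod_cast h0
  have h1 : 1 + Real.logb 2 S.card ≤ d := by
    rw [← Real.logb_self_eq_one (b := 2) one_lt_two, ← Real.logb_mul two_ne_zero hpos.ne',
      Real.logb_le_iff_le_rpow one_lt_two (by positivity), Real.rpow_natCast]
    exact_mod_cast h
  nlinarith

/-! ### Edge connectivity -/

theorem edgeConnectivity_graph_le {d : ℕ} (hd : 0 < d) : edgeConnectivity (graph d) ≤ d := by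
  have hb : ∀ k ∈ {k : ℕ | (graph d).IsEdgeConnected k}, k ≤ d := by
    intro k hk
    by_contra! hlt
    let v : Vertex d := fun _ => false
    -- removing the `d` edges at `v` isolates `v`
    let F : Finset (Sym2 (Vertex d)) := Finset.univ.image fun i : Fin d => s(v, flip v i)
    have hF : (F : Set (Sym2 (Vertex d))).encard < k := by
      rw [Set.encard_coe_eq_coe_finsetCard]
      have : F.card ≤ (Finset.univ : Finset (Fin d)).card := Finset.card_image_le
      rw [Finset.card_univ, Fintype.card_fin] at this
      exact_mod_cast this.trans_lt hlt
    obtain ⟨p⟩ := hk v (flip v ⟨0, hd⟩) hF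
    have hne : v ≠ flip v ⟨0, hd⟩ := (flip_ne v _).symm
    generalize flip v ⟨0, hd⟩ = w at p hne
    cases p with
    | nil => exact hne rfl
    | cons h q =>
      rw [SimpleGraph.deleteEdges_adj] at h
      obtain ⟨⟨i, rfl⟩, h⟩ := h
      exact h (Finset.mem_coe.2 (Finset.mem_image_of_mem _ (Finset.mem_univ i)))
  exact csSup_le ⟨0, SimpleGraph.IsEdgeConnected.zero⟩ hb

/-! ### The protocol -/

/-- The local states of the acknowledging protocol. -/
structure AckState (d : ℕ) where
  /-- the parity of the clock: `true` in the time steps reserved for acknowledgements -/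
  ack : Bool
  /-- whether the vertex is informed -/
  informed : Bool
  /-- the ports through which a message has ever been received -/
  heard : Fin d → Bool
  /-- the ports through which a message was received in the previous time step -/
  fresh : Fin d → Bool

/-- In the steps of even number every informed vertex sends through all ports through which it has
not received anything so far; in the steps of odd number every vertex acknowledges the messages
received in the previous step. Messages are mere signals. -/
def ackProtocol (d : ℕ) : Protocol d where
  State := AckState d
  Msg := Unit
  init b := ⟨false, b, fun _ => false, fun _ => false⟩
  send s p :=
    if s.ack then (if s.fresh p then some () else none)
    else if s.informed && !s.heard p then some () else none
  next s inbox :=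
    ⟨!s.ack, s.informed || decide (∃ p, (inbox p).isSome),
      fun p => s.heard p || (inbox p).isSome, fun p => (inbox p).isSome⟩

namespace Run

section General

variable {d : ℕ} {P : Protocol d} (R : Run P)

theorem mem_sent {t : ℕ} {e : Arc d} :
    e ∈ R.sent t ↔ (R.message (R.state t) e).isSome := by
  rw [sent, Finset.mem_filter]
  exact and_iff_right (Finset.mem_univ e)

theorem mem_delivered {t : ℕ} {e : Arc d} :
    e ∈ R.delivered t ↔ e ∈ R.sent t ∧ e ∉ R.lost t := by
  simp [delivered]

theorem informed_subset_succ (t : ℕ) : R.informed t ⊆ R.informed (t + 1) := by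
  intro v hv
  simp only [informed, Finset.mem_union]
  exact Or.inl hv

theorem informed_mono : Monotone R.informed :=
  monotone_nat_of_le_succ R.informed_subset_succ

theorem head_mem_informed_succ {t : ℕ} {e : Arc d} (he : e ∈ R.delivered t)
    (h : e.1 ∈ R.informed t) : e.head ∈ R.informed (t + 1) := by
  simp only [informed, Finset.mem_union, Finset.mem_filter, Finset.mem_univ, true_and]
  exact Or.inr ⟨e, he, h, rfl⟩

theorem uninformed_eq_compl (t : ℕ) : R.uninformed t = (R.informed t)ᶜ := by
  ext v
  simp [uninformed]

open Classical in
/-- The passive arcs after `t` time steps. -/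
noncomputable def passive (t : ℕ) : Finset (Arc d) :=
  Finset.univ.filter fun e => R.IsPassive t e

open Classical in
/-- The active arcs after `t` time steps: those that lead from an informed vertex and are not
passive. They are the hyperactive arcs and the boundary of the set of informed vertices. -/
noncomputable def active (t : ℕ) : Finset (Arc d) :=
  Finset.univ.filter fun e => e.1 ∈ R.informed t ∧ ¬ R.IsPassive t e

theorem mem_passive {t : ℕ} {e : Arc d} : e ∈ R.passive t ↔ R.IsPassive t e := by
  simp [passive]

theorem mem_active {t : ℕ} {e : Arc d} :
    e ∈ R.active t ↔ e.1 ∈ R.informed t ∧ ¬ R.IsPassive t e := by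
  simp [active]

variable {R} in
theorem IsPassive.mono {s t : ℕ} (h : s ≤ t) {e : Arc d} (he : R.IsPassive s e) :
    R.IsPassive t e :=
  ⟨R.informed_mono h he.1, he.2.imp fun _ hr => ⟨hr.1.trans_le h, hr.2⟩⟩

theorem passive_mono : Monotone R.passive := fun _ _ h _ he =>
  R.mem_passive.2 ((R.mem_passive.1 he).mono h)

theorem card_active_add_card_passive (t : ℕ) :
    (R.active t).card + (R.passive t).card = (R.informed t).card * d := by
  classical
  rw [← card_arcs_from, ← Finset.card_union_of_disjoint]
  · congr 1
    ext e
    simp only [Finset.mem_union, mem_active, mem_passive, Finset.mem_filter, Finset.mem_univ,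
      true_and]
    constructor
    · rintro (h | h)
      exacts [h.1, h.1]
    · tauto
  · rw [Finset.disjoint_left]
    intro e h1 h2
    exact (R.mem_active.1 h1).2 (R.mem_passive.1 h2)

theorem hyperactive_subset_active (t : ℕ) : R.hyperactive t ⊆ R.active t := by
  intro e he
  simp only [hyperactive, Finset.mem_filter, Finset.mem_univ, true_and] at he
  exact R.mem_active.2 ⟨he.1, he.2.2⟩

variable {R} in
/-- Passive arcs lead to informed vertices, since only those send. -/
theorem OnlyInformedSend.boundary_subset_active (h : R.OnlyInformedSend) (t : ℕ) :
    boundary (R.informed t) ⊆ R.active t := by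
  intro e he
  simp only [boundary, Finset.mem_filter, Finset.mem_univ, true_and] at he
  refine R.mem_active.2 ⟨he.1, fun hp => he.2 ?_⟩
  obtain ⟨s, hs, hd⟩ := hp.2
  exact R.informed_mono hs.le (h s _ (R.mem_delivered.1 hd).1)

variable {R} in
/-- Among `m` messages at least `min {m - (d - 1), (1 - α) m}` are delivered. -/
theorem Admissible.card_sent_le {α : ℝ} (hR : R.Admissible α) (hα : 0 ≤ α) (hd : 0 < d) (t : ℕ) :
    ((R.sent t).card : ℝ) ≤
      (R.delivered t).card + max ((d : ℝ) - 1) (α * (R.sent t).card) := by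
  classical
  obtain ⟨hsub, hcard⟩ := hR t
  have h1 : (R.delivered t).card + (R.lost t).card = (R.sent t).card := by
    rw [delivered]
    exact Finset.card_sdiff_add_card_eq_card hsub
  have h2 : ((R.lost t).card : ℝ) ≤ max ((d : ℝ) - 1) (α * (R.sent t).card) := by
    have h3 : ((R.lost t).card : ℝ) ≤ (faultBound (graph d) α (R.sent t).card : ℕ) := by
      exact_mod_cast hcard
    refine h3.trans ?_
    rw [faultBound, Nat.cast_max]
    refine max_le_max ?_ (Nat.floor_le (by positivity))
    have : edgeConnectivity (graph d) - 1 ≤ d - 1 :=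
      Nat.sub_le_sub_right (edgeConnectivity_graph_le hd) 1
    calc ((edgeConnectivity (graph d) - 1 : ℕ) : ℝ) ≤ ((d - 1 : ℕ) : ℝ) := by exact_mod_cast this
      _ = (d : ℝ) - 1 := by rw [Nat.cast_sub hd, Nat.cast_one]
  have h4 : ((R.delivered t).card : ℝ) + (R.lost t).card = (R.sent t).card := by
    exact_mod_cast h1
  linarith

/-- The messages that leave the set of `k` informed vertices reach each other vertex at most `k`
times. All their targets are informed in the next step. -/
theorem card_delivered_boundary_le (t : ℕ) :
    (R.delivered t ∩ boundary (R.informed t)).card ≤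
      (R.informed t).card * (R.informed (t + 1)).card := by
  classical
  rw [← Finset.card_product]
  refine Finset.card_le_card_of_injOn (fun e => (e.1, e.head)) ?_ ?_
  · intro e he
    simp only [Finset.coe_inter, Set.mem_inter_iff, Finset.mem_coe, boundary, Finset.mem_filter,
      Finset.mem_univ, true_and] at he
    simp only [Finset.coe_product, Set.mem_prod, Finset.mem_coe]
    exact ⟨he.2.1, R.head_mem_informed_succ he.1 he.2.1⟩
  · intro e _ f _ h
    obtain ⟨h1, h2⟩ := Prod.mk.inj h
    exact Arc.eq_of_tail_head h1 h2

end General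

/-! ### Runs of the protocol -/

section Ack

variable {d : ℕ} (R : Run (ackProtocol d))

/-- The state of a vertex, typed as `AckState d` to give access to its fields. -/
noncomputable def ackState (t : ℕ) (v : Vertex d) : AckState d := R.state t v

theorem mem_sent_iff {t : ℕ} {e : Arc d} :
    e ∈ R.sent t ↔
      (if (R.ackState t e.1).ack then (R.ackState t e.1).fresh ((R.port e.1).symm e.2) = true
       else (R.ackState t e.1).informed = true ∧
         (R.ackState t e.1).heard ((R.port e.1).symm e.2) = false) := by
  rw [mem_sent]
  change ((ackProtocol d).send (R.ackState t e.1) _).isSome = true ↔ _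
  simp only [ackProtocol]
  split_ifs <;> simp_all

open Classical in
/-- The messages received by `v` in time step `t`, port by port. -/
noncomputable def inbox (t : ℕ) (v : Vertex d) (p : Fin d) : Option (ackProtocol d).Msg :=
  if Arc.opposite (v, R.port v p) ∈ R.lost t then none
  else R.message (R.state t) (Arc.opposite (v, R.port v p))

theorem isSome_inbox {t : ℕ} {v : Vertex d} {p : Fin d} :
    (R.inbox t v p).isSome ↔ Arc.opposite (v, R.port v p) ∈ R.delivered t := by
  rw [mem_delivered, inbox]
  by_cases h : Arc.opposite (v, R.port v p) ∈ R.lost t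
  · simp [h]
  · rw [if_neg h, and_iff_left h, mem_sent]

theorem ackState_succ (t : ℕ) (v : Vertex d) :
    R.ackState (t + 1) v =
      ⟨!(R.ackState t v).ack, (R.ackState t v).informed || decide (∃ p, (R.inbox t v p).isSome),
        fun p => (R.ackState t v).heard p || (R.inbox t v p).isSome,
        fun p => (R.inbox t v p).isSome⟩ :=
  rfl

theorem ack_eq (t : ℕ) (v : Vertex d) : (R.ackState t v).ack = decide (Odd t) := by
  induction t with
  | zero => rfl
  | succ t ih => simp only [ackState_succ, ih, Nat.odd_add_one, decide_not]

theorem heard_iff (t : ℕ) (v : Vertex d) (p : Fin d) :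
    (R.ackState t v).heard p = true ↔ ∃ s < t, Arc.opposite (v, R.port v p) ∈ R.delivered s := by
  induction t with
  | zero =>
    constructor
    · intro h
      cases (h : false = true)
    · simp
  | succ t ih =>
    simp only [ackState_succ, Bool.or_eq_true, ih, isSome_inbox, Nat.lt_succ_iff_lt_or_eq]
    constructor
    · rintro (⟨s, hs, h⟩ | h)
      exacts [⟨s, Or.inl hs, h⟩, ⟨t, Or.inr rfl, h⟩]
    · rintro ⟨s, hs | rfl, h⟩
      exacts [Or.inl ⟨s, hs, h⟩, Or.inr h]

/-- A vertex has received a message in step `t` exactly if it is the head of a delivered arc. -/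
theorem exists_isSome_inbox {t : ℕ} {v : Vertex d} :
    (∃ p, (R.inbox t v p).isSome) ↔ ∃ e ∈ R.delivered t, e.head = v := by
  simp only [isSome_inbox]
  constructor
  · rintro ⟨p, hp⟩
    exact ⟨_, hp, Arc.head_opposite _⟩
  · rintro ⟨e, he, rfl⟩
    refine ⟨(R.port e.head).symm e.2, ?_⟩
    rw [Equiv.apply_symm_apply]
    have : Arc.opposite (e.head, e.2) = e := e.opposite_opposite
    rwa [this]

/-- The vertices know whether they are informed, and only informed ones send. -/
theorem informed_iff_and_sent (t : ℕ) :
    (∀ v, (R.ackState t v).informed = true ↔ v ∈ R.informed t) ∧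
      ∀ e ∈ R.sent t, e.1 ∈ R.informed t := by
  -- a port is fresh only at a vertex that has just received a message
  have key : ∀ t, (∀ v, (R.ackState t v).informed = true ↔ v ∈ R.informed t) →
      (∀ v p, (R.ackState t v).fresh p = true → (R.ackState t v).informed = true) →
      ∀ e ∈ R.sent t, e.1 ∈ R.informed t := by
    intro t h1 h2 e he
    rw [mem_sent_iff] at he
    rw [← h1]
    split_ifs at he with h
    exacts [h2 _ _ he, he.1]
  induction t with
  | zero =>
    have h1 : ∀ v, (R.ackState 0 v).informed = true ↔ v ∈ R.informed 0 := by
      intro v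
      change decide (v = R.initiator) = true ↔ _
      simp [informed]
    refine ⟨h1, key 0 h1 fun v p h => ?_⟩
    cases (h : false = true)
  | succ t ih =>
    have h1 : ∀ v, (R.ackState (t + 1) v).informed = true ↔ v ∈ R.informed (t + 1) := by
      intro v
      simp only [ackState_succ, Bool.or_eq_true, ih.1, decide_eq_true_eq, exists_isSome_inbox,
        informed, Finset.mem_union, Finset.mem_filter, Finset.mem_univ, true_and]
      refine or_congr_right (exists_congr fun e => and_congr_right fun he => ?_)
      exact (and_iff_right (ih.2 e (R.mem_delivered.1 he).1)).symm
    refine ⟨h1, key (t + 1) h1 fun v p h => ?_⟩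
    simp only [ackState_succ, Bool.or_eq_true, decide_eq_true_eq] at h ⊢
    exact Or.inr ⟨p, h⟩

theorem onlyInformedSend : R.OnlyInformedSend := fun t => (R.informed_iff_and_sent t).2

theorem sent_two_mul (r : ℕ) : R.sent (2 * r) = R.active (2 * r) := by
  ext e
  rw [mem_sent_iff, ack_eq, mem_active, if_neg (by simp), (R.informed_iff_and_sent _).1,
    ← Bool.not_eq_true, heard_iff, Equiv.apply_symm_apply]
  refine and_congr_right fun h => not_congr ?_
  exact (and_iff_right h).symm

theorem sent_two_mul_add_one (r : ℕ) :
    R.sent (2 * r + 1) = (R.delivered (2 * r)).map ⟨Arc.opposite, Arc.opposite_injective⟩ := by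
  ext e
  have h : Odd (2 * r + 1) := ⟨r, rfl⟩
  rw [mem_sent_iff, ack_eq, if_pos (by simp [h]), ackState_succ]
  simp only [isSome_inbox, Equiv.apply_symm_apply, Finset.mem_map, Function.Embedding.coeFn_mk]
  constructor
  · intro h
    exact ⟨_, h, Arc.opposite_opposite _⟩
  · rintro ⟨f, hf, rfl⟩
    change f.opposite.opposite ∈ _
    rwa [Arc.opposite_opposite]

/-- An acknowledgement that is delivered makes an active arc passive. -/
theorem card_passive_add_card_delivered_le (r : ℕ) :
    (R.passive (2 * r)).card + (R.delivered (2 * r + 1)).card ≤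
      (R.passive (2 * (r + 1))).card := by
  classical
  rw [← Finset.card_map ⟨Arc.opposite, Arc.opposite_injective⟩ (s := R.delivered (2 * r + 1)),
    ← Finset.card_union_of_disjoint]
  · apply Finset.card_le_card
    intro e he
    rcases Finset.mem_union.1 he with he | he
    · exact R.passive_mono (by omega) he
    · obtain ⟨f, hf, rfl⟩ := Finset.mem_map.1 he
      have h1 := (R.mem_delivered.1 hf).1
      rw [sent_two_mul_add_one] at h1
      obtain ⟨g, hg, rfl⟩ := Finset.mem_map.1 h1
      simp only [Function.Embedding.coeFn_mk, Arc.opposite_opposite] at hf ⊢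
      refine R.mem_passive.2 ⟨?_, 2 * r + 1, by omega, hf⟩
      exact R.informed_mono (by omega) (R.onlyInformedSend _ _ (R.mem_delivered.1 hg).1)
  · rw [Finset.disjoint_left]
    intro e he he'
    obtain ⟨f, hf, rfl⟩ := Finset.mem_map.1 he'
    have h1 := (R.mem_delivered.1 hf).1
    rw [sent_two_mul_add_one] at h1
    obtain ⟨g, hg, rfl⟩ := Finset.mem_map.1 h1
    have h2 := (R.mem_delivered.1 hg).1
    rw [sent_two_mul] at h2
    simp only [Function.Embedding.coeFn_mk, Arc.opposite_opposite] at he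
    exact (R.mem_active.1 h2).2 (R.mem_passive.1 he)

end Ack

end Run

/-! ### Sets with few outgoing arcs -/

open Filter Topology in
theorem exists_forall_mul_lt_two_rpow {ε : ℝ} (hε : 0 < ε) (X : ℝ) :
    ∃ d₀ : ℕ, ∀ d : ℕ, d₀ ≤ d → X * d < (2 : ℝ) ^ (ε * d) := by
  have hr0 : (0 : ℝ) < 2 ^ (-ε) := by positivity
  have hr1 : (2 : ℝ) ^ (-ε) < 1 := Real.rpow_lt_one_of_one_lt_of_neg one_lt_two (by linarith)
  have h := (tendsto_self_mul_const_pow_of_lt_one hr0.le hr1).const_mul X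
  rw [mul_zero] at h
  obtain ⟨d₀, hd₀⟩ := eventually_atTop.1 (h.eventually_lt_const one_pos)
  refine ⟨d₀, fun d hd => ?_⟩
  have h1 := hd₀ d hd
  have h2 : (2 : ℝ) ^ (ε * d) * ((2 : ℝ) ^ (-ε)) ^ d = 1 := by
    rw [← Real.rpow_mul_natCast two_pos.le, ← Real.rpow_add two_pos]
    simp
  have h3 : (0 : ℝ) < 2 ^ (ε * d) := by positivity
  calc X * d = 2 ^ (ε * d) * (X * (d * ((2 : ℝ) ^ (-ε)) ^ d)) := by
        linear_combination (-(X * d)) * h2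
    _ < 2 ^ (ε * d) * 1 := mul_lt_mul_of_pos_left h1 h3
    _ = 2 ^ (ε * d) := mul_one _

/-- In high dimension a set of at most half of the vertices with at most `X (d - 1)` outgoing arcs
has at most `X / (1 - ε)` elements: a set of size up to `2 ^ (ε d)` has at least `(1 - ε) d`
outgoing arcs per element, and a larger one has at least as many outgoing arcs as elements. -/
theorem exists_forall_card_le_of_card_boundary_le {ε : ℝ} (hε0 : 0 < ε) (hε1 : ε < 1) {X : ℝ}
    (hX : 0 < X) :
    ∃ d₀ : ℕ, ∀ d : ℕ, d₀ ≤ d → ∀ S : Finset (Vertex d), 2 * S.card ≤ 2 ^ d →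
      ((boundary S).card : ℝ) ≤ X * ((d : ℝ) - 1) → (S.card : ℝ) ≤ X / (1 - ε) := by
  obtain ⟨d₀, hd₀⟩ := exists_forall_mul_lt_two_rpow hε0 X
  refine ⟨max d₀ 1, fun d hd S hS hb => ?_⟩
  have hd1 : (1 : ℝ) ≤ d := by exact_mod_cast (le_max_right d₀ 1).trans hd
  have hlt := hd₀ d ((le_max_left d₀ 1).trans hd)
  have h1 := mul_sub_logb_le_card_boundary S
  have h2 := card_le_card_boundary S hS
  have hXd : X * ((d : ℝ) - 1) ≤ X * d := by nlinarith
  rw [le_div_iff₀ (by linarith)]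
  rcases S.card.eq_zero_or_pos with h0 | h0
  · simp [h0, hX.le]
  have hpos : (0 : ℝ) < S.card := by exact_mod_cast h0
  rcases le_or_gt (Real.logb 2 S.card) (ε * d) with hl | hl
  · have h3 : (S.card : ℝ) * (d - ε * d) ≤ X * d := by
      refine le_trans ?_ (h1.trans (hb.trans hXd))
      exact mul_le_mul_of_nonneg_left (by linarith) hpos.le
    refine le_of_mul_le_mul_right ?_ (lt_of_lt_of_le one_pos hd1)
    linarith
  · rw [Real.lt_logb_iff_rpow_lt one_lt_two hpos] at hl
    linarith

/-! ### Growth of the ratio of passive to other arcs -/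

/-- If `P` and `N` are parts of a whole, and a round moves the amount `γ m` from `N` to `P`, where
`P ≤ d m` or `N ≤ (d + 1) m`, then the ratio `P / N` grows at least by the factor
`1 + γ / (d + 1)`. -/
theorem ratio_growth {P P' N N' m γ d : ℝ} (hP : 0 ≤ P) (hN' : 0 ≤ N') (hd : 0 ≤ d)
    (hγ : 0 ≤ γ) (hm : 0 ≤ m) (hPP' : P + γ * m ≤ P') (hsum : P' + N' = P + N)
    (h : P ≤ d * m ∨ N ≤ (d + 1) * m) :
    (1 + γ / (d + 1)) * P * N' ≤ P' * N := by
  have hγm : 0 ≤ γ * m := by positivity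
  have hd1 : 0 < d + 1 := by linarith
  have hx : 0 ≤ γ / (d + 1) := by positivity
  have hxm : γ / (d + 1) * ((d + 1) * m) = γ * m := by field_simp
  rcases h with h | h
  · have h1 : γ / (d + 1) * P ≤ γ * m := by
      rw [← hxm]
      exact mul_le_mul_of_nonneg_left (by linarith) hx
    exact mul_le_mul (by linarith) (by linarith) hN' (by linarith)
  · have h1 : γ / (d + 1) * N ≤ γ * m := by
      rw [← hxm]
      exact mul_le_mul_of_nonneg_left h hx
    have h2 : γ / (d + 1) * N' ≤ γ / (d + 1) * N :=
      mul_le_mul_of_nonneg_left (by linarith) hx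
    calc (1 + γ / (d + 1)) * P * N' = P * (N' + γ / (d + 1) * N') := by ring
      _ ≤ P' * N := mul_le_mul (by linarith) (by linarith) (by positivity) (by linarith)

theorem sq_mul_two_pow_lt {d : ℕ} {γ : ℝ} (hγ : 0 < γ) :
    ((d : ℝ) * 2 ^ d) ^ 2 < (1 + γ / (d + 1)) ^ (4 * d * ⌈(d + 1) / γ⌉₊) := by
  have hx : 0 < γ / ((d : ℝ) + 1) := by positivity
  have h1 : (2 : ℝ) ≤ (1 + γ / (d + 1)) ^ ⌈(d + 1) / γ⌉₊ := by
    refine le_trans ?_ (one_add_mul_le_pow (by linarith) _)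
    have h3 : 1 ≤ (⌈((d : ℝ) + 1) / γ⌉₊ : ℝ) * (γ / (d + 1)) := by
      calc (1 : ℝ) = (d + 1) / γ * (γ / (d + 1)) := by field_simp
        _ ≤ _ := mul_le_mul_of_nonneg_right (Nat.le_ceil _) hx.le
    linarith
  have h2 : (d : ℝ) < 2 ^ d := by exact_mod_cast d.lt_two_pow_self
  calc ((d : ℝ) * 2 ^ d) ^ 2 < ((2 : ℝ) ^ d * 2 ^ d) ^ 2 := by gcongr
    _ = 2 ^ (4 * d) := by rw [← pow_add, ← pow_mul]; congr 1; ring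
    _ ≤ ((1 + γ / (d + 1)) ^ ⌈(d + 1) / γ⌉₊) ^ (4 * d) := by gcongr
    _ = _ := by rw [← pow_mul, mul_comm (4 * d)]

/-! ### Progress against an admissible adversary -/

namespace Run

variable {d : ℕ} (R : Run (ackProtocol d))

/-- As long as at least `X (d - 1)` arcs are active, with `X = 1 / (α (1 - α))`, there are enough
messages and then enough acknowledgements for the fraction `α` to be the larger of the two bounds
on the losses. -/
theorem card_passive_add_le {α : ℝ} (hα0 : 0 < α) (hα1 : α < 1) (hR : R.Admissible α) (hd : 0 < d)
    {r : ℕ} (h : 1 / (α * (1 - α)) * ((d : ℝ) - 1) ≤ (R.active (2 * r)).card) :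
    ((R.passive (2 * r)).card : ℝ) + (1 - α) ^ 2 * (R.active (2 * r)).card ≤
      (R.passive (2 * (r + 1))).card := by
  have hα1' : 0 < 1 - α := by linarith
  have h1 := hR.card_sent_le hα0.le hd (2 * r)
  have h2 := hR.card_sent_le hα0.le hd (2 * r + 1)
  rw [sent_two_mul] at h1
  rw [sent_two_mul_add_one, Finset.card_map] at h2
  have h3 : ((R.passive (2 * r)).card : ℝ) + (R.delivered (2 * r + 1)).card ≤
      (R.passive (2 * (r + 1))).card := by
    exact_mod_cast R.card_passive_add_card_delivered_le r
  rw [one_div_mul_eq_div, div_le_iff₀ (by positivity)] at h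
  set m : ℝ := ((R.active (2 * r)).card : ℝ)
  have hm : 0 ≤ m := Nat.cast_nonneg _
  have h4 : (d : ℝ) - 1 ≤ α * m := by nlinarith [mul_nonneg (mul_nonneg hα0.le hα0.le) hm]
  rw [max_eq_right h4] at h1
  have h5 : (d : ℝ) - 1 ≤ α * (R.delivered (2 * r)).card := by nlinarith
  rw [max_eq_right h5] at h2
  nlinarith

/-- The first message that is delivered informs a second vertex. -/
theorem two_le_card_informed_one {α : ℝ} (hα0 : 0 < α) (hα1 : α < 1) (hR : R.Admissible α)
    (hd : 0 < d) : 2 ≤ (R.informed 1).card := by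
  have hd' : (0 : ℝ) < d := by exact_mod_cast hd
  have h1 := hR.card_sent_le hα0.le hd 0
  have h2 : (R.sent 0).card = d := by
    have h3 := R.card_active_add_card_passive 0
    have h4 : R.passive 0 = ∅ := by
      ext e
      simp [mem_passive, IsPassive]
    rw [h4] at h3
    rw [show R.sent 0 = R.active 0 from R.sent_two_mul 0]
    simpa [informed] using h3
  rw [h2] at h1
  have h5 : max ((d : ℝ) - 1) (α * d) < d := max_lt (by linarith) (by nlinarith)
  have h6 : 0 < (R.delivered 0).card := by
    rw [← Nat.cast_pos (α := ℝ)]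
    linarith
  obtain ⟨e, he⟩ := Finset.card_pos.1 h6
  have h7 := R.onlyInformedSend 0 e (R.mem_delivered.1 he).1
  exact Finset.one_lt_card.2 ⟨e.head, R.head_mem_informed_succ he h7, e.1,
    R.informed_subset_succ 0 h7, flip_ne _ _⟩

/-- Two informed vertices have about `2 d` outgoing arcs, so that their messages inform a number of
vertices proportional to `d`. -/
theorem le_card_informed_four {α : ℝ} (hα0 : 0 < α) (hα1 : α < 1) (hR : R.Admissible α)
    (hd : 0 < d) {K : ℕ} (hK : 2 * (K : ℝ) ^ 2 ≤ (1 - α) * d) : K ≤ (R.informed 4).card := by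
  classical
  rcases le_or_gt K (R.informed 2).card with h | hlt
  · exact h.trans (Finset.card_le_card (R.informed_mono (by norm_num)))
  refine le_trans ?_ (Finset.card_le_card (R.informed_subset_succ 3))
  have hk2 : 2 ≤ (R.informed 2).card :=
    (R.two_le_card_informed_one hα0 hα1 hR hd).trans
      (Finset.card_le_card (R.informed_subset_succ 1))
  have h1 := hR.card_sent_le hα0.le hd 2
  have hsent : R.sent 2 = R.active 2 := R.sent_two_mul 1
  have h2 : ((R.sent 2).card : ℝ) ≤ (R.informed 2).card * d := by
    rw [hsent]
    exact_mod_cast (Nat.le_add_right _ _).trans_eq (R.card_active_add_card_passive 2)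
  have h3 := mul_sub_logb_le_card_boundary (R.informed 2)
  have h4 : (R.delivered 2).card + (boundary (R.informed 2)).card ≤
      (R.sent 2).card + (R.delivered 2 ∩ boundary (R.informed 2)).card := by
    rw [← Finset.card_union_add_card_inter]
    refine Nat.add_le_add_right (Finset.card_le_card (Finset.union_subset ?_ ?_)) _
    · exact fun e he => (R.mem_delivered.1 he).1
    · rw [hsent]
      exact R.onlyInformedSend.boundary_subset_active 2
  have h5 := R.card_delivered_boundary_le 2
  have h4' : ((R.delivered 2).card : ℝ) + (boundary (R.informed 2)).card ≤
      (R.sent 2).card + (R.informed 2).card * (R.informed 3).card := by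
    exact_mod_cast h4.trans (Nat.add_le_add_left h5 _)
  have hkK : ((R.informed 2).card : ℝ) ≤ K := by exact_mod_cast hlt.le
  have hk2' : (2 : ℝ) ≤ (R.informed 2).card := by exact_mod_cast hk2
  have hd' : (0 : ℝ) < d := by exact_mod_cast hd
  have hlog : Real.logb 2 (R.informed 2).card ≤ (R.informed 2).card := by
    rw [Real.logb_le_iff_le_rpow one_lt_two (by linarith), Real.rpow_natCast]
    exact_mod_cast (Nat.lt_two_pow_self).le
  set k : ℝ := ((R.informed 2).card : ℝ)
  have hkl : k * Real.logb 2 k ≤ (K : ℝ) ^ 2 := by nlinarith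
  have h6 : max ((d : ℝ) - 1) (α * (R.sent 2).card) ≤ k * d - (1 - α) * d := by
    refine max_le ?_ ?_
    · nlinarith
    · have h7 : α * ((R.sent 2).card : ℝ) ≤ α * (k * d) := mul_le_mul_of_nonneg_left h2 hα0.le
      nlinarith [mul_nonneg (mul_nonneg (sub_nonneg.2 hα1.le) (by linarith : 0 ≤ k - 1)) hd'.le]
  have h8 : (K : ℝ) * K ≤ K * (R.informed 3).card := by
    have h9 : k * ((R.informed 3).card : ℝ) ≤ K * (R.informed 3).card :=
      mul_le_mul_of_nonneg_right hkK (Nat.cast_nonneg _)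
    nlinarith
  have hK0 : (0 : ℝ) < K := by linarith
  exact_mod_cast le_of_mul_le_mul_left h8 hK0

/-- The number of arcs that are not passive. -/
theorem arcs_sub_passive (r : ℕ) :
    (d : ℝ) * 2 ^ d - (R.passive r).card = (R.active r).card + (R.informed r)ᶜ.card * d := by
  have h1 : ((R.active r).card : ℝ) + (R.passive r).card = (R.informed r).card * d := by
    exact_mod_cast R.card_active_add_card_passive r
  have h2 : ((R.informed r).card : ℝ) + (R.informed r)ᶜ.card = 2 ^ d := by
    have := Finset.card_add_card_compl (R.informed r)
    rw [Fintype.card_fun, Fintype.card_bool, Fintype.card_fin] at this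
    exact_mod_cast this
  rw [← h2]
  linarith

/-- Either the passive arcs or the arcs that are not passive are at most about `d` times as many as
the active ones: at most half of the vertices are informed, or at most half are not. -/
theorem passive_le_or_nonpassive_le (t : ℕ) :
    ((R.passive t).card : ℝ) ≤ d * (R.active t).card ∨
      (d : ℝ) * 2 ^ d - (R.passive t).card ≤ (d + 1) * (R.active t).card := by
  have hb : ((boundary (R.informed t)).card : ℝ) ≤ (R.active t).card := by
    exact_mod_cast Finset.card_le_card (R.onlyInformedSend.boundary_subset_active t)
  have hd : (0 : ℝ) ≤ d := Nat.cast_nonneg _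
  have h1 : ((R.active t).card : ℝ) + (R.passive t).card = (R.informed t).card * d := by
    exact_mod_cast R.card_active_add_card_passive t
  rcases le_total (2 * (R.informed t).card) (2 ^ d) with h | h
  · left
    have h2 := (card_le_card_boundary _ h).trans hb
    have h3 : (0 : ℝ) ≤ (R.active t).card := Nat.cast_nonneg _
    nlinarith
  · right
    have h2 := Finset.card_add_card_compl (R.informed t)
    rw [Fintype.card_fun, Fintype.card_bool, Fintype.card_fin] at h2
    have h3 := card_le_card_boundary (R.informed t)ᶜ (by omega)
    rw [card_boundary_compl] at h3
    rw [arcs_sub_passive]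
    nlinarith [h3.trans hb]

/-- If many arcs were active in all rounds considered, the ratio of passive to other arcs would
grow beyond its maximal value. -/
theorem exists_card_active_le {α : ℝ} (hα0 : 0 < α) (hα1 : α < 1) (hR : R.Admissible α)
    (hd : 0 < d) :
    ∃ r, 2 ≤ r ∧ r ≤ 3 + 4 * d * ⌈((d : ℝ) + 1) / (1 - α) ^ 2⌉₊ ∧
      ((R.active (2 * r)).card : ℝ) ≤ 1 / (α * (1 - α)) * ((d : ℝ) - 1) := by
  by_contra! hcon
  set n := 4 * d * ⌈((d : ℝ) + 1) / (1 - α) ^ 2⌉₊ with hn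
  have hα1' : 0 < 1 - α := by linarith
  have hγ : 0 < (1 - α) ^ 2 := by positivity
  have hd1 : (1 : ℝ) ≤ d := by exact_mod_cast hd
  have hX : 0 ≤ 1 / (α * (1 - α)) * ((d : ℝ) - 1) :=
    mul_nonneg (by positivity) (by linarith)
  set T : ℝ := (d : ℝ) * 2 ^ d with hT
  obtain ⟨p, hp⟩ : ∃ p : ℕ → ℝ, ∀ r, p r = (R.passive (2 * r)).card := ⟨_, fun _ => rfl⟩
  obtain ⟨m, hm⟩ : ∃ m : ℕ → ℝ, ∀ r, m r = (R.active (2 * r)).card := ⟨_, fun _ => rfl⟩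
  have hp0 : ∀ r, 0 ≤ p r := fun r => by rw [hp]; exact Nat.cast_nonneg _
  have hm0 : ∀ r, 0 ≤ m r := fun r => by rw [hm]; exact Nat.cast_nonneg _
  have hpm : ∀ r, p r + m r ≤ T := by
    intro r
    have := R.arcs_sub_passive (2 * r)
    have h0 : (0 : ℝ) ≤ (R.informed (2 * r))ᶜ.card * d := by positivity
    rw [hp, hm]
    linarith
  have hmpos : ∀ r, 2 ≤ r → r ≤ 3 + n → 1 ≤ m r := by
    intro r h2 h3
    rw [hm]
    exact Nat.one_le_cast.2 (Nat.cast_pos.1 (hX.trans_lt (hcon r h2 h3)))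
  have hstep : ∀ r, 2 ≤ r → r ≤ 3 + n → p r + (1 - α) ^ 2 * m r ≤ p (r + 1) := by
    intro r h2 h3
    rw [hp, hp, hm]
    exact R.card_passive_add_le hα0 hα1 hR hd (hcon r h2 h3).le
  have hor : ∀ r, p r ≤ d * m r ∨ T - p r ≤ (d + 1) * m r := by
    intro r
    rw [hp, hm]
    exact R.passive_le_or_nonpassive_le (2 * r)
  have hp3 : ∀ j, 1 ≤ p (3 + j) := by
    intro j
    have h0 : 0 < p 3 := by
      have h1 := hstep 2 le_rfl (by omega)
      have h2 := hmpos 2 le_rfl (by omega)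
      have h3 := hp0 2
      have h4 : 0 < (1 - α) ^ 2 * m 2 := mul_pos hγ (by linarith)
      norm_num at h1
      linarith
    rw [hp] at h0
    rw [hp]
    have h4 : 1 ≤ (R.passive (2 * 3)).card := Nat.cast_pos.1 h0
    exact Nat.one_le_cast.2 (h4.trans (Finset.card_le_card (R.passive_mono (by omega))))
  have hgrow : ∀ j ≤ n, (1 + (1 - α) ^ 2 / ((d : ℝ) + 1)) ^ j * (T - p (3 + j)) ≤
      T * p (3 + j) := by
    intro j
    induction j with
    | zero =>
      intro _
      have h1 := hp3 0
      have h2 : 0 ≤ T := by positivity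
      rw [pow_zero]
      nlinarith
    | succ j ih =>
      intro hj
      have ih := ih (by omega)
      have hpj := hp3 j
      have h1 := ratio_growth (d := d) (N := T - p (3 + j)) (N' := T - p (3 + j + 1)) (hp0 (3 + j))
        (by linarith [hpm (3 + j + 1), hm0 (3 + j + 1)]) (by linarith) hγ.le (hm0 (3 + j))
        (hstep (3 + j) (by omega) (by omega)) (by ring)
        (hor (3 + j))
      rw [← add_assoc]
      refine le_of_mul_le_mul_left ?_ (by linarith : 0 < p (3 + j))
      set y : ℝ := 1 + (1 - α) ^ 2 / ((d : ℝ) + 1) with hy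
      have hy0 : 0 ≤ y := by positivity
      calc p (3 + j) * (y ^ (j + 1) * (T - p (3 + j + 1)))
          = y ^ j * (y * p (3 + j) * (T - p (3 + j + 1))) := by ring
        _ ≤ y ^ j * (p (3 + j + 1) * (T - p (3 + j))) :=
          mul_le_mul_of_nonneg_left h1 (pow_nonneg hy0 _)
        _ = p (3 + j + 1) * (y ^ j * (T - p (3 + j))) := by ring
        _ ≤ p (3 + j + 1) * (T * p (3 + j)) := mul_le_mul_of_nonneg_left ih (hp0 _)
        _ = p (3 + j) * (T * p (3 + j + 1)) := by ring
  have h1 := hgrow n le_rfl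
  have h2 := sq_mul_two_pow_lt (d := d) hγ
  rw [← hn, ← hT] at h2
  have h3 := hpm (3 + n)
  have h4 := hmpos (3 + n) (by omega) le_rfl
  have h5 : (0 : ℝ) ≤ (1 + (1 - α) ^ 2 / ((d : ℝ) + 1)) ^ n := by positivity
  have h6 : T * p (3 + n) ≤ T * T := mul_le_mul_of_nonneg_left (by linarith) (by positivity)
  nlinarith

end Run

end Hypercube

theorem mainTheorem2 (α : ℝ) (hα0 : 0 < α) (hα1 : α < 1) (ε : ℝ) (hε0 : 0 < ε) (hε1 : ε < 1) :
    ∃ (C : ℝ) (d₀ : ℕ), ∀ d : ℕ, d₀ ≤ d →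
      ∃ P : Hypercube.Protocol d, ∀ R : Hypercube.Run P, R.Admissible α →
        R.OnlyInformedSend ∧
        ∃ t : ℕ, (t : ℝ) ≤ C * (d : ℝ) ^ 2 ∧
          (∀ t' : ℕ, t ≤ t' →
            ((R.uninformed t').card : ℝ) ≤ (1 / (α * (1 - α))) / (1 - ε)) ∧
          ((R.hyperactive t).card : ℝ) ≤ (1 / (α * (1 - α))) * ((d : ℝ) - 1) := by
  have hα1' : 0 < 1 - α := by linarith
  set X : ℝ := 1 / (α * (1 - α)) with hXdef
  have hX : 0 < X := by positivity
  obtain ⟨d₁, hd₁⟩ := Hypercube.exists_forall_card_le_of_card_boundary_le hε0 hε1 hX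
  obtain ⟨d₂, hd₂⟩ := Hypercube.exists_forall_card_le_of_card_boundary_le
    (ε := 1 / 2) (by norm_num) (by norm_num) hX
  -- with more than `2 X` informed vertices, few active arcs mean that most vertices are informed
  obtain ⟨K, hK⟩ := exists_nat_gt (X / (1 - 1 / 2))
  obtain ⟨d₃, hd₃⟩ := exists_nat_ge (2 * (K : ℝ) ^ 2 / (1 - α))
  refine ⟨14 + 16 / (1 - α) ^ 2, max (max d₁ d₂) (max d₃ 1), fun d hd => ?_⟩
  simp only [max_le_iff] at hd
  obtain ⟨⟨hdd₁, hdd₂⟩, hdd₃, hd0⟩ := hd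
  refine ⟨Hypercube.ackProtocol d, fun R hR => ⟨R.onlyInformedSend, ?_⟩⟩
  obtain ⟨r, hr2, hr, hact⟩ := R.exists_card_active_le hα0 hα1 hR hd0
  have hK4 : K ≤ (R.informed 4).card := by
    refine R.le_card_informed_four hα0 hα1 hR hd0 ?_
    have h1 : 2 * (K : ℝ) ^ 2 / (1 - α) ≤ d := hd₃.trans (by exact_mod_cast hdd₃)
    rw [div_le_iff₀ hα1'] at h1
    linarith
  have hb : ((Hypercube.boundary (R.informed (2 * r))).card : ℝ) ≤ X * ((d : ℝ) - 1) := by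
    refine le_trans ?_ hact
    exact_mod_cast Finset.card_le_card (R.onlyInformedSend.boundary_subset_active (2 * r))
  have hmany : 2 ^ d < 2 * (R.informed (2 * r)).card := by
    by_contra! hle
    have h1 := hd₂ d hdd₂ _ hle hb
    have h2 : (K : ℝ) ≤ (R.informed (2 * r)).card := by
      exact_mod_cast hK4.trans (Finset.card_le_card (R.informed_mono (by omega)))
    linarith
  refine ⟨2 * r, ?_, fun t' ht' => ?_, ?_⟩
  · have hd1 : (1 : ℝ) ≤ d := by exact_mod_cast hd0
    have h1 : (r : ℝ) ≤ 3 + 4 * d * (⌈((d : ℝ) + 1) / (1 - α) ^ 2⌉₊ : ℝ) := by exact_mod_cast hr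
    have h2 : (⌈((d : ℝ) + 1) / (1 - α) ^ 2⌉₊ : ℝ) ≤ (2 / (1 - α) ^ 2 + 1) * d := by
      refine (Nat.ceil_lt_add_one (by positivity)).le.trans ?_
      have h3 : ((d : ℝ) + 1) / (1 - α) ^ 2 ≤ 2 * d / (1 - α) ^ 2 := by gcongr; linarith
      calc _ ≤ 2 * d / (1 - α) ^ 2 + (d : ℝ) := add_le_add h3 hd1
        _ = _ := by ring
    have h4 : 4 * (d : ℝ) * (⌈((d : ℝ) + 1) / (1 - α) ^ 2⌉₊ : ℝ) ≤
        4 * d * ((2 / (1 - α) ^ 2 + 1) * d) := mul_le_mul_of_nonneg_left h2 (by positivity)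
    have h5 : (1 : ℝ) ≤ (d : ℝ) ^ 2 := one_le_pow₀ hd1
    push_cast
    calc 2 * (r : ℝ) ≤ 6 * (d : ℝ) ^ 2 + 2 * (4 * d * ((2 / (1 - α) ^ 2 + 1) * d)) := by linarith
      _ = (14 + 16 / (1 - α) ^ 2) * (d : ℝ) ^ 2 := by ring
  · have h1 := Finset.card_add_card_compl (R.informed (2 * r))
    rw [Fintype.card_fun, Fintype.card_bool, Fintype.card_fin] at h1
    have h2 := hd₁ d hdd₁ (R.informed (2 * r))ᶜ (by omega)
      (by rwa [Hypercube.card_boundary_compl])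
    refine le_trans ?_ h2
    rw [R.uninformed_eq_compl]
    exact_mod_cast Finset.card_le_card (Finset.compl_subset_compl.2 (R.informed_mono ht'))
  · refine le_trans ?_ hact
    exact_mod_cast Finset.card_le_card (R.hyperactive_subset_active (2 * r))
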